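/- Let $\alpha=(\alpha_n)_{n\in\mathbb N}$ be a positive, strictly increasing sequence of real numbers tending to infinity, and let $(s_k)_{k\in\mathbb N}\subset(1,\infty)$ be a strictly increasing sequence tending to infinity. Put $v_k(n):=s_k^{-\alpha_n}$ and let $c_0(v_k)$ be the Banach space of all complex sequences $x=(x_n)$ with $\lim_{n\to\infty} v_k(n)x_n=0$, with norm $q_k(x)=\sup_n v_k(n)|x_n|$. Let $E_\alpha:=\operatorname{ind}_k c_0(v_k)$, that is, $E_\alpha=\bigcup_k c_0(v_k)\subset\mathbb C^{\mathbb N}$ with the finest locally convex Hausdorff topology for which all inclusions $c_0(v_k)\hookrightarrow E_\alpha$ are continuous. The Cesàro operator $$\mathsf C x:=\Bigl(x_1,\frac{x_1+x_2}{2},\dots,\frac{x_1+\dots+x_n}{n},\dots\Bigr)$$ is a continuous linear operator of $E_\alpha$ into itself. If $E_\alpha$ is a nuclear locally convex space, then $\mathsf C$ is neither compact nor weakly compact; that is, there is no neighbourhood $U$ of $0$ in $E_\alpha$ such that $\mathsf C(U)$ is relatively compact in $E_\alpha$, and none such that $\mathsf C(U)$ is relatively weakly compact in $E_\alpha$. 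-/

import Mathlib

open Filter Topology

noncomputable section

/-! ### Nuclear locally convex spaces, weakly compact operators -/

section General

variable {E : Type*} [AddCommGroup E] [Module ℂ E]

/-- A copy of `E`, seminormed by `p`. -/
def LocalSpace (_p : Seminorm ℂ E) : Type _ := E

instance (p : Seminorm ℂ E) : SeminormedAddCommGroup (LocalSpace p) :=
  p.toSeminormedAddCommGroup

instance (p : Seminorm ℂ E) : NormedSpace ℂ (LocalSpace p) where
  __ := (inferInstanceAs (Module ℂ E) : Module ℂ E)
  norm_smul_le a x := (map_smul_eq_mul p a x).le

/-- The local Banach space of the seminorm `p`: the (Hausdorff) completion of `E` with respect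
to `p`, that is, the completion of the normed space `E / ker p`. -/
abbrev LocalBanachSpace (p : Seminorm ℂ E) : Type _ := UniformSpace.Completion (LocalSpace p)

/-- The canonical linear map of `E` into the local Banach space of `p`. -/
def toLocalBanachSpace (p : Seminorm ℂ E) : E →ₗ[ℂ] LocalBanachSpace p where
  toFun x := ((show LocalSpace p from x) : UniformSpace.Completion (LocalSpace p))
  map_add' x y := UniformSpace.Completion.coe_add (α := LocalSpace p) x y
  map_smul' a x := UniformSpace.Completion.coe_smul (X := LocalSpace p) a x

theorem norm_toLocalBanachSpace (p : Seminorm ℂ E) (x : E) :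
    ‖toLocalBanachSpace p x‖ = p x :=
  UniformSpace.Completion.norm_coe (E := LocalSpace p) x

variable [TopologicalSpace E]

/-- A linear map `T` from a topological vector space `E` into a Banach space `F` is nuclear if
`T x = ∑ₙ λₙ fₙ(x) yₙ` with `(λₙ)` absolutely summable, `(fₙ)` an equicontinuous sequence of
continuous linear functionals on `E`, and `(yₙ)` a bounded sequence in `F`. -/
def IsNuclearMap {F : Type*} [NormedAddCommGroup F] [NormedSpace ℂ F] (T : E →ₗ[ℂ] F) : Prop :=
  ∃ (c : ℕ → ℂ) (f : ℕ → E →L[ℂ] ℂ) (y : ℕ → F),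
    Summable (fun n => ‖c n‖) ∧
    Equicontinuous (fun (n : ℕ) (x : E) => f n x) ∧
    Bornology.IsBounded (Set.range y) ∧
    ∀ x, HasSum (fun n => (c n * f n x) • y n) (T x)

variable (E) in
/-- A locally convex space is nuclear if for every continuous seminorm `p` the canonical map into
the local Banach space of `p` is nuclear. -/
def IsNuclearSpace [IsTopologicalAddGroup E] [ContinuousSMul ℂ E] [LocallyConvexSpace ℝ E] :
    Prop :=
  ∀ p : Seminorm ℂ E, Continuous p → IsNuclearMap (toLocalBanachSpace p)

/-- `T` is weakly compact if it maps some neighbourhood of `0` onto a set whose closure in the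
weak topology is weakly compact. -/
def IsWeaklyCompactOperator (T : E →L[ℂ] E) : Prop :=
  ∃ U ∈ 𝓝 (0 : E), IsCompact (closure (toWeakSpace ℂ E '' (T '' U)))

end General

/-! ### Weighted `c₀` spaces -/

/-- The sequences `x` for which the weighted sequence `v x` tends to zero. -/
def weightedC0Submodule (v : ℕ → ℝ) : Submodule ℂ (ℕ → ℂ) where
  carrier := {x | Tendsto (fun n => v n • x n) atTop (𝓝 0)}
  zero_mem' := by simp
  add_mem' {x y} hx hy := by simpa [mul_add] using Tendsto.add hx hy
  smul_mem' a x hx := by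
    have h : Tendsto (fun n => a • (v n • x n)) atTop (𝓝 (a • 0)) := Tendsto.const_smul hx a
    simpa [mul_left_comm] using h

/-- The weighted space `c₀(v)`, to be normed by `q(x) = supₙ |vₙ xₙ|`. -/
def WeightedC0 (v : ℕ → ℝ) : Type := weightedC0Submodule v

namespace WeightedC0

variable {v : ℕ → ℝ}

instance : AddCommGroup (WeightedC0 v) := inferInstanceAs (AddCommGroup (weightedC0Submodule v))

instance : Module ℂ (WeightedC0 v) := inferInstanceAs (Module ℂ (weightedC0Submodule v))

/-- The sequence underlying an element of `c₀(v)`. -/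
def toSeq : WeightedC0 v →ₗ[ℂ] (ℕ → ℂ) := (weightedC0Submodule v).subtype

theorem bddAbove (x : WeightedC0 v) : BddAbove (Set.range fun n => ‖v n • toSeq x n‖) :=
  (Tendsto.norm x.2).bddAbove_range

variable (v) in
/-- The norm `q(x) = supₙ |vₙ xₙ|` of `c₀(v)` (it is a norm if `v` has no zeros). -/
def q : Seminorm ℂ (WeightedC0 v) :=
  Seminorm.of (fun x => ⨆ n, ‖v n • toSeq x n‖)
    (fun x y => ciSup_le fun n => by
      rw [map_add, Pi.add_apply, smul_add]
      exact (norm_add_le _ _).trans (add_le_add (le_ciSup x.bddAbove n) (le_ciSup y.bddAbove n)))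
    (fun a x => by
      rw [Real.mul_iSup_of_nonneg (norm_nonneg a)]
      congr 1
      ext n
      rw [map_smul, Pi.smul_apply, smul_comm, norm_smul])

theorem q_apply (x : WeightedC0 v) : q v x = ⨆ n, ‖v n • toSeq x n‖ := rfl

instance : SeminormedAddCommGroup (WeightedC0 v) := (q v).toSeminormedAddCommGroup

theorem norm_def (x : WeightedC0 v) : ‖x‖ = ⨆ n, ‖v n • toSeq x n‖ := rfl

instance : NormedSpace ℂ (WeightedC0 v) where
  norm_smul_le a x := (map_smul_eq_mul (q v) a x).le

theorem le_norm (x : WeightedC0 v) (n : ℕ) : ‖v n • toSeq x n‖ ≤ ‖x‖ := le_ciSup x.bddAbove n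

end WeightedC0

/-! ### The dual power series space `E_α` -/

/-- `α` is a positive, strictly increasing sequence tending to infinity. Sequences are indexed from
`0`: `α n` is the `(n + 1)`-st term. -/
structure IsExponentSequence (α : ℕ → ℝ) : Prop where
  pos : ∀ n, 0 < α n
  strictMono : StrictMono α
  tendsto : Tendsto α atTop atTop

/-- `s` is a strictly increasing sequence in `(1, ∞)` tending to infinity. -/
structure IsStepSequence (s : ℕ → ℝ) : Prop where
  one_lt : ∀ k, 1 < s k
  strictMono : StrictMono s
  tendsto : Tendsto s atTop atTop

/-- The weights `v_k(n) = s_k ^ (-α_n)`. -/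
def stepWeight (α s : ℕ → ℝ) (k n : ℕ) : ℝ := s k ^ (-α n)

/-- The linear hull of the spaces `c₀(v_k)` in the space of all sequences; it is their union, as
these increase with `k`, see `mem_coEchelonSubmodule`. -/
def coEchelonSubmodule (α s : ℕ → ℝ) : Submodule ℂ (ℕ → ℂ) :=
  ⨆ k, weightedC0Submodule (stepWeight α s k)

/-- The co-echelon space `E_α = ind_k c₀(v_k)`. -/
def CoEchelon (α s : ℕ → ℝ) : Type := coEchelonSubmodule α s

theorem stepWeight_pos {α s : ℕ → ℝ} (hs : IsStepSequence s) (k n : ℕ) :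
    0 < stepWeight α s k n :=
  Real.rpow_pos_of_pos (zero_lt_one.trans (hs.one_lt k)) _

theorem stepWeight_antitone {α s : ℕ → ℝ} (hα : IsExponentSequence α) (hs : IsStepSequence s)
    (k : ℕ) : Antitone (stepWeight α s k) := fun _ _ h =>
  Real.rpow_le_rpow_of_exponent_le (hs.one_lt k).le (neg_le_neg (hα.strictMono.monotone h))

theorem weightedC0Submodule_mono {α s : ℕ → ℝ} (hα : IsExponentSequence α)
    (hs : IsStepSequence s) : Monotone fun k => weightedC0Submodule (stepWeight α s k) := by
  intro k l hkl x hx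
  have hx' : Tendsto (fun n => stepWeight α s k n • x n) atTop (𝓝 0) := hx
  refine squeeze_zero_norm (fun n => ?_) (tendsto_zero_iff_norm_tendsto_zero.1 hx')
  rw [norm_smul, norm_smul, Real.norm_of_nonneg (stepWeight_pos hs l n).le,
    Real.norm_of_nonneg (stepWeight_pos hs k n).le]
  refine mul_le_mul_of_nonneg_right ?_ (norm_nonneg _)
  exact Real.rpow_le_rpow_of_nonpos (zero_lt_one.trans (hs.one_lt k)) (hs.strictMono.monotone hkl)
    (neg_nonpos.2 (hα.pos n).le)

/-- `E_α` is the union of the spaces `c₀(v_k)`. -/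
theorem mem_coEchelonSubmodule {α s : ℕ → ℝ} (hα : IsExponentSequence α)
    (hs : IsStepSequence s) {x : ℕ → ℂ} :
    x ∈ coEchelonSubmodule α s ↔ ∃ k, x ∈ weightedC0Submodule (stepWeight α s k) :=
  Submodule.mem_iSup_of_directed _ (weightedC0Submodule_mono hα hs).directed_le

namespace CoEchelon

variable {α s : ℕ → ℝ}

instance : AddCommGroup (CoEchelon α s) := inferInstanceAs (AddCommGroup (coEchelonSubmodule α s))

instance : Module ℂ (CoEchelon α s) := inferInstanceAs (Module ℂ (coEchelonSubmodule α s))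

/-- The sequence underlying an element of `E_α`. -/
def toSeq : CoEchelon α s →ₗ[ℂ] (ℕ → ℂ) := (coEchelonSubmodule α s).subtype

theorem toSeq_injective : Function.Injective (toSeq : CoEchelon α s → ℕ → ℂ) :=
  Subtype.val_injective

variable (α s) in
/-- The natural inclusion of `c₀(v_k)` into `E_α`. -/
def incl (k : ℕ) : WeightedC0 (stepWeight α s k) →ₗ[ℂ] CoEchelon α s :=
  Submodule.inclusion (le_iSup (fun k => weightedC0Submodule (stepWeight α s k)) k)

theorem toSeq_incl (k : ℕ) (x : WeightedC0 (stepWeight α s k)) :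
    toSeq (incl α s k x) = WeightedC0.toSeq x := rfl

/-- The locally convex inductive limit topology of `E_α`: the finest locally convex topology for
which all inclusions of the spaces `c₀(v_k)` are continuous. It is Hausdorff, see
`CoEchelon.t2Space`. -/
instance : TopologicalSpace (CoEchelon α s) :=
  sInf {t : TopologicalSpace (CoEchelon α s) |
    @IsTopologicalAddGroup (CoEchelon α s) t _ ∧
    @ContinuousSMul ℂ (CoEchelon α s) _ _ t ∧
    @LocallyConvexSpace ℝ (CoEchelon α s) _ _ _ _ t ∧
    ∀ k, @Continuous _ _ _ t (incl α s k)}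

instance : IsTopologicalAddGroup (CoEchelon α s) :=
  topologicalAddGroup_sInf fun _ ht => ht.1

instance : ContinuousSMul ℂ (CoEchelon α s) :=
  continuousSMul_sInf fun _ ht => ht.2.1

instance : LocallyConvexSpace ℝ (CoEchelon α s) :=
  .sInf fun _ ht => ht.2.2.1

theorem continuous_incl (k : ℕ) : Continuous (incl α s k) :=
  continuous_sInf_rng.2 fun _ ht => ht.2.2.2 k

/-- A linear map of `E_α` into a locally convex space is continuous if its restrictions to the
spaces `c₀(v_k)` are. -/
theorem continuous_of_incl {F : Type*} [AddCommGroup F] [Module ℂ F] [TopologicalSpace F]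
    [IsTopologicalAddGroup F] [ContinuousSMul ℂ F] [LocallyConvexSpace ℝ F]
    (T : CoEchelon α s →ₗ[ℂ] F) (hT : ∀ k, Continuous fun x => T (incl α s k x)) :
    Continuous T := by
  rw [continuous_iff_le_induced]
  refine sInf_le ⟨topologicalAddGroup_induced T, continuousSMul_induced T,
    LocallyConvexSpace.induced (T.restrictScalars ℝ), fun k => ?_⟩
  exact continuous_induced_rng.2 (hT k)

theorem t2Space (hs : IsStepSequence s) : T2Space (CoEchelon α s) := by
  refine T2Space.of_injective_continuous (toSeq_injective (α := α) (s := s))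
    (continuous_of_incl toSeq fun k => continuous_pi fun n => ?_)
  let ev : WeightedC0 (stepWeight α s k) →ₗ[ℂ] ℂ := LinearMap.proj n ∘ₗ WeightedC0.toSeq
  refine AddMonoidHomClass.continuous_of_bound ev (stepWeight α s k n)⁻¹ fun x => ?_
  rw [inv_mul_eq_div, le_div_iff₀ (stepWeight_pos hs k n), mul_comm]
  have h := x.le_norm n
  rwa [norm_smul, Real.norm_of_nonneg (stepWeight_pos hs k n).le] at h

end CoEchelon

/-! ### The Cesàro operator -/

/-- The Cesàro operator on the space of all sequences, `x ↦ ((x₁ + ⋯ + xₙ) / n)ₙ` in the usual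
indexing from `1`. -/
def cesaroSeq : (ℕ → ℂ) →ₗ[ℂ] (ℕ → ℂ) where
  toFun x n := (∑ i ∈ Finset.range (n + 1), x i) / ((n : ℂ) + 1)
  map_add' x y := by
    ext n
    simp only [Pi.add_apply, Finset.sum_add_distrib, add_div]
  map_smul' a x := by
    ext n
    simp only [Pi.smul_apply, smul_eq_mul, ← Finset.mul_sum, mul_div_assoc, RingHom.id_apply]

theorem norm_smul_cesaroSeq_le {v : ℕ → ℝ} (hv : ∀ n, 0 < v n) (hv' : Antitone v) (x : ℕ → ℂ)
    (n : ℕ) : ‖v n • cesaroSeq x n‖ ≤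
      ((n + 1 : ℕ) : ℝ)⁻¹ * ∑ i ∈ Finset.range (n + 1), ‖v i • x i‖ := by
  have h1 : ‖(n : ℂ) + 1‖ = ((n + 1 : ℕ) : ℝ) := by
    rw [← Nat.cast_succ, Complex.norm_natCast]
  rw [norm_smul, Real.norm_of_nonneg (hv n).le]
  change v n * ‖(∑ i ∈ Finset.range (n + 1), x i) / ((n : ℂ) + 1)‖ ≤ _
  rw [norm_div, h1, div_eq_inv_mul, mul_left_comm]
  refine mul_le_mul_of_nonneg_left ?_ (by positivity)
  refine (mul_le_mul_of_nonneg_left (norm_sum_le _ _) (hv n).le).trans ?_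
  rw [Finset.mul_sum]
  refine Finset.sum_le_sum fun i hi => ?_
  rw [norm_smul, Real.norm_of_nonneg (hv i).le]
  exact mul_le_mul_of_nonneg_right (hv' (Nat.lt_succ_iff.1 (Finset.mem_range.1 hi)))
    (norm_nonneg _)

theorem cesaroSeq_mem_weightedC0 {v : ℕ → ℝ} (hv : ∀ n, 0 < v n) (hv' : Antitone v) {x : ℕ → ℂ}
    (hx : x ∈ weightedC0Submodule v) : cesaroSeq x ∈ weightedC0Submodule v := by
  have hx' : Tendsto (fun n => v n • x n) atTop (𝓝 0) := hx
  have h := (tendsto_zero_iff_norm_tendsto_zero.1 hx').cesaro.comp (tendsto_add_atTop_nat 1)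
  exact squeeze_zero_norm (norm_smul_cesaroSeq_le hv hv' x) h

/-- The Cesàro operator on `c₀(v)`, for a positive decreasing weight `v`. -/
def cesaroC0 {v : ℕ → ℝ} (hv : ∀ n, 0 < v n) (hv' : Antitone v) :
    WeightedC0 v →ₗ[ℂ] WeightedC0 v :=
  cesaroSeq.restrict fun _ => cesaroSeq_mem_weightedC0 hv hv'

theorem continuous_cesaroC0 {v : ℕ → ℝ} (hv : ∀ n, 0 < v n) (hv' : Antitone v) :
    Continuous (cesaroC0 hv hv') := by
  refine AddMonoidHomClass.continuous_of_bound (cesaroC0 hv hv') 1 fun x => ?_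
  rw [one_mul, WeightedC0.norm_def]
  refine ciSup_le fun n => (norm_smul_cesaroSeq_le hv hv' (WeightedC0.toSeq x) n).trans ?_
  rw [inv_mul_le_iff₀ (by positivity)]
  refine (Finset.sum_le_sum fun i _ => x.le_norm i).trans ?_
  simp

theorem cesaroSeq_mem_coEchelon {α s : ℕ → ℝ} (hα : IsExponentSequence α)
    (hs : IsStepSequence s) {x : ℕ → ℂ} (hx : x ∈ coEchelonSubmodule α s) :
    cesaroSeq x ∈ coEchelonSubmodule α s := by
  rw [mem_coEchelonSubmodule hα hs] at hx ⊢
  exact hx.imp fun k =>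
    cesaroSeq_mem_weightedC0 (stepWeight_pos hs k) (stepWeight_antitone hα hs k)

/-- The Cesàro operator as a continuous linear operator on `E_α`. -/
def cesaro {α s : ℕ → ℝ} (hα : IsExponentSequence α) (hs : IsStepSequence s) :
    CoEchelon α s →L[ℂ] CoEchelon α s where
  toLinearMap := cesaroSeq.restrict fun _ => cesaroSeq_mem_coEchelon hα hs
  cont := CoEchelon.continuous_of_incl _ fun k =>
    (CoEchelon.continuous_incl k).comp
      (continuous_cesaroC0 (stepWeight_pos hs k) (stepWeight_antitone hα hs k))

theorem toSeq_cesaro {α s : ℕ → ℝ} (hα : IsExponentSequence α) (hs : IsStepSequence s)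
    (x : CoEchelon α s) :
    (cesaro hα hs x).toSeq = cesaroSeq x.toSeq := rfl

end

/-! Weakly compact sets are weakly bounded, so it suffices to find, for each neighbourhood `U` of
`0`, a continuous functional unbounded on the Cesàro image of `U`. Nuclearity enters only through
the growth of `α`. A nuclear map is absolutely summing (`IsNuclearMap.exists_sum_le`), so every
weight giving a continuous supremum seminorm is summable. The harmonic weight is not summable, hence
some `t > 0` makes `(n + 1) * t ^ (-α n)` arbitrarily small
(`exists_frequently_small_of_isNuclearSpace`). The Cesàro operator maps `e_n - e_{n+1}` to `e_n / (n
+ 1)`, with coordinates counted from `0`. It thus loses only a factor `n + 1`, which is small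
against `t ^ α n` for suitable `n`. Scaled differences of this kind in `U` and a rapidly decreasing
sum of coordinate functionals yield the unboundedness (`exists_functional_unbounded_cesaro`). -/

noncomputable section

/-! ### Nuclear maps are absolutely summing -/

section General

variable {E : Type*} [AddCommGroup E] [Module ℂ E]

theorem denseRange_toLocalBanachSpace (p : Seminorm ℂ E) : DenseRange (toLocalBanachSpace p) :=
  UniformSpace.Completion.denseRange_coe (α := LocalSpace p)

/-- A linear functional dominated by `p` factors through the local Banach space of `p`. -/
theorem exists_functional_localBanachSpace (p : Seminorm ℂ E) (f : E →ₗ[ℂ] ℂ)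
    (hf : ∀ x, ‖f x‖ ≤ p x) :
    ∃ g : LocalBanachSpace p →L[ℂ] ℂ, (∀ y, ‖g y‖ ≤ ‖y‖) ∧
      ∀ x, g (toLocalBanachSpace p x) = f x := by
  have h : ∀ x, ‖f x‖ ≤ 1 * ‖toLocalBanachSpace p x‖ := fun x => by
    rw [one_mul, norm_toLocalBanachSpace]
    exact hf x
  refine ⟨f.extendOfNorm (toLocalBanachSpace p), fun y => ?_, fun x => ?_⟩
  · simpa using LinearMap.norm_extendOfNorm_apply_le (denseRange_toLocalBanachSpace p) 1 h y
  · exact LinearMap.extendOfNorm_eq (denseRange_toLocalBanachSpace p) ⟨1, h⟩ x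

theorem exists_norm_le_one_mul_eq_norm (z : ℂ) : ∃ u : ℂ, ‖u‖ ≤ 1 ∧ u * z = (‖z‖ : ℂ) := by
  rcases eq_or_ne z 0 with rfl | hz
  · exact ⟨0, by simp⟩
  · have hz' : (‖z‖ : ℂ) ≠ 0 := by simpa using hz
    refine ⟨‖z‖ / z, ?_, div_mul_cancel₀ _ hz⟩
    rw [norm_div, Complex.norm_real, norm_norm, div_self (norm_ne_zero_iff.2 hz)]

/-- A nuclear map sends families whose absolutely convex hulls lie in a suitable neighbourhood of
`0` to absolutely summable families, with a uniform bound. -/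
theorem IsNuclearMap.exists_sum_le [TopologicalSpace E] {F : Type*} [NormedAddCommGroup F]
    [NormedSpace ℂ F] {T : E →ₗ[ℂ] F} (hT : IsNuclearMap T) :
    ∃ U ∈ 𝓝 (0 : E), ∃ C : ℝ, ∀ (I : Finset ℕ) (x : ℕ → E) (g : ℕ → F →L[ℂ] ℂ),
      (∀ i y, ‖g i y‖ ≤ ‖y‖) →
      (∀ u : ℕ → ℂ, (∀ i, ‖u i‖ ≤ 1) → ∑ i ∈ I, u i • x i ∈ U) →
      ∑ i ∈ I, ‖g i (T (x i))‖ ≤ C := by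
  obtain ⟨c, f, y, hc, hf, hy, hT⟩ := hT
  obtain ⟨B, hB⟩ := hy.exists_norm_le
  have hB' : ∀ m, ‖y m‖ ≤ B := fun m => hB _ ⟨m, rfl⟩
  have hB0 : 0 ≤ B := (norm_nonneg _).trans (hB' 0)
  -- Equicontinuity gives one neighbourhood on which all `f m` are bounded by `1`.
  have hU := Metric.equicontinuousAt_iff_right.1 (hf 0) 1 one_pos
  refine ⟨_, hU, ∑' m, ‖c m‖ * B, fun I x g hg hx => ?_⟩
  have hfx : ∀ m, ∑ i ∈ I, ‖f m (x i)‖ ≤ 1 := by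
    intro m
    -- With these phases, `f m` of a single combination in `U` equals the sum of the absolute
    -- values.
    choose u hu1 hu2 using fun i => exists_norm_le_one_mul_eq_norm (f m (x i))
    have h : dist (f m 0) (f m (∑ i ∈ I, u i • x i)) < 1 := hx u hu1 m
    rw [map_zero, dist_zero_left, map_sum] at h
    simp only [map_smul, smul_eq_mul, hu2] at h
    rw [← Complex.ofReal_sum, Complex.norm_real,
      Real.norm_of_nonneg (Finset.sum_nonneg fun i _ => norm_nonneg _)] at h
    exact h.le
  have hsum : ∀ i ∈ I, Summable fun m => ‖c m‖ * ‖f m (x i)‖ * B := by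
    intro i hi
    refine Summable.mul_right B (Summable.of_nonneg_of_le (fun m => by positivity)
      (fun m => ?_) hc)
    exact mul_le_of_le_one_right (norm_nonneg _)
      ((Finset.single_le_sum (f := fun i => ‖f m (x i)‖) (fun _ _ => norm_nonneg _) hi).trans
        (hfx m))
  have hle : ∀ i ∈ I, ‖g i (T (x i))‖ ≤ ∑' m, ‖c m‖ * ‖f m (x i)‖ * B := by
    intro i hi
    refine ((hg i _).trans_eq (by rw [(hT (x i)).tsum_eq])).trans
      (tsum_of_norm_bounded (hsum i hi).hasSum fun m => ?_)
    rw [norm_smul, norm_mul]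
    exact mul_le_mul_of_nonneg_left (hB' m) (by positivity)
  refine (Finset.sum_le_sum hle).trans ?_
  -- Summing over `I` inside the series lets `hfx` bound each term independently of `I`.
  rw [← Summable.tsum_finsetSum hsum]
  refine Summable.tsum_le_tsum (fun m => ?_) (summable_sum hsum) (hc.mul_right B)
  rw [← Finset.sum_mul, ← Finset.mul_sum]
  exact mul_le_mul_of_nonneg_right (mul_le_of_le_one_right (norm_nonneg _) (hfx m)) hB0

end General

/-! ### Finitely supported sequences -/

namespace WeightedC0

variable {v : ℕ → ℝ}

variable (v) in
/-- A finitely supported sequence as an element of `c₀(v)`. -/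
def ofFinsupp : (ℕ →₀ ℂ) →ₗ[ℂ] WeightedC0 v where
  toFun x := ⟨x, show Tendsto (fun n => v n • x n) atTop (𝓝 0) by
    refine tendsto_const_nhds.congr' ?_
    rw [← Nat.cofinite_eq_atTop]
    filter_upwards [x.hasFiniteSupport.compl_mem_cofinite] with n hn
    rw [Function.notMem_support.1 hn, smul_zero]⟩
  map_add' _ _ := rfl
  map_smul' _ _ := rfl

theorem toSeq_ofFinsupp (x : ℕ →₀ ℂ) : toSeq (ofFinsupp v x) = x := rfl

theorem norm_ofFinsupp_le {x : ℕ →₀ ℂ} {r : ℝ} (h : ∀ n, ‖v n • x n‖ ≤ r) :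
    ‖ofFinsupp v x‖ ≤ r :=
  ciSup_le h

end WeightedC0

namespace CoEchelon

variable {α s : ℕ → ℝ}

variable (α s) in
/-- A finitely supported sequence as an element of `E_α`. -/
def ofFinsupp : (ℕ →₀ ℂ) →ₗ[ℂ] CoEchelon α s :=
  incl α s 0 ∘ₗ WeightedC0.ofFinsupp _

theorem toSeq_ofFinsupp (x : ℕ →₀ ℂ) : toSeq (ofFinsupp α s x) = x := rfl

theorem exists_incl_eq (hα : IsExponentSequence α) (hs : IsStepSequence s)
    (x : CoEchelon α s) : ∃ k y, incl α s k y = x := by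
  obtain ⟨k, hk⟩ := (mem_coEchelonSubmodule hα hs).1 x.2
  exact ⟨k, ⟨_, hk⟩, rfl⟩

/-- Neighbourhoods of `0` contain the finitely supported elements of a ball of `c₀(v_k)`. -/
theorem exists_forall_ofFinsupp_mem {U : Set (CoEchelon α s)} (hU : U ∈ 𝓝 0) (k : ℕ) :
    ∃ r > 0, ∀ x : ℕ →₀ ℂ, (∀ n, ‖stepWeight α s k n • x n‖ ≤ r) → ofFinsupp α s x ∈ U := by
  have h : incl α s k ⁻¹' U ∈ 𝓝 0 :=
    (continuous_incl k).continuousAt.preimage_mem_nhds (by rwa [map_zero])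
  obtain ⟨ε, hε, h⟩ := Metric.mem_nhds_iff.1 h
  refine ⟨ε / 2, half_pos hε, fun x hx => ?_⟩
  -- The embedding through `c₀(v_0)` agrees with the one through `c₀(v_k)`, since both keep the
  -- underlying sequence.
  refine h (show WeightedC0.ofFinsupp _ x ∈ _ from mem_ball_zero_iff.2 ?_)
  exact (WeightedC0.norm_ofFinsupp_le hx).trans_lt (half_lt_self hε)


/-! ### Supremum seminorms and the consequence of nuclearity -/

theorem norm_toSeq_incl_le (hs : IsStepSequence s) (k : ℕ)
    (x : WeightedC0 (stepWeight α s k)) (n : ℕ) :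
    ‖toSeq (incl α s k x) n‖ ≤ s k ^ α n * ‖x‖ := by
  have hk := zero_lt_one.trans (hs.one_lt k)
  have h := x.le_norm n
  rw [norm_smul, Real.norm_of_nonneg (stepWeight_pos hs k n).le, stepWeight,
    Real.rpow_neg hk.le, inv_mul_le_iff₀ (Real.rpow_pos_of_pos hk _)] at h
  exact h

theorem exists_mul_norm_incl_le (hs : IsStepSequence s) {w : ℕ → ℝ} (hw : ∀ n, 0 ≤ w n)
    (k : ℕ) (hk : BddAbove (Set.range fun n => w n * s k ^ α n)) :
    ∃ M, ∀ (x : WeightedC0 (stepWeight α s k)) n, w n * ‖toSeq (incl α s k x) n‖ ≤ M * ‖x‖ := by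
  obtain ⟨M, hM⟩ := hk
  refine ⟨M, fun x n => ?_⟩
  refine (mul_le_mul_of_nonneg_left (norm_toSeq_incl_le hs k x n) (hw n)).trans ?_
  rw [← mul_assoc]
  exact mul_le_mul_of_nonneg_right (hM ⟨n, rfl⟩) (norm_nonneg _)

/-- If the weight `w` decreases fast enough, then `x ↦ supₙ wₙ |xₙ|` is a continuous seminorm
on `E_α`. -/
theorem exists_continuous_seminorm (hα : IsExponentSequence α) (hs : IsStepSequence s)
    {w : ℕ → ℝ} (hw : ∀ n, 0 ≤ w n)
    (hws : ∀ k, BddAbove (Set.range fun n => w n * s k ^ α n)) :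
    ∃ p : Seminorm ℂ (CoEchelon α s), Continuous p ∧ ∀ x n, w n * ‖toSeq x n‖ ≤ p x := by
  have hbdd : ∀ x : CoEchelon α s, BddAbove (Set.range fun n => w n * ‖toSeq x n‖) := by
    intro x
    obtain ⟨k, y, rfl⟩ := exists_incl_eq hα hs x
    obtain ⟨M, hM⟩ := exists_mul_norm_incl_le hs hw k (hws k)
    exact ⟨M * ‖y‖, Set.forall_mem_range.2 (hM y)⟩
  let p : Seminorm ℂ (CoEchelon α s) := Seminorm.of (fun x => ⨆ n, w n * ‖toSeq x n‖)
    (fun x y => ciSup_le fun n => by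
      refine le_trans ?_ (add_le_add (le_ciSup (hbdd x) n) (le_ciSup (hbdd y) n))
      rw [map_add, Pi.add_apply, ← mul_add]
      exact mul_le_mul_of_nonneg_left (norm_add_le _ _) (hw n))
    (fun a x => by
      rw [Real.mul_iSup_of_nonneg (norm_nonneg a)]
      congr 1
      ext n
      rw [map_smul, Pi.smul_apply, norm_smul, mul_left_comm])
  refine ⟨p, ?_, fun x n => le_ciSup (hbdd x) n⟩
  -- Viewing `p` as the norm of a linear map allows its continuity to be tested on the steps
  -- `c₀(v_k)`.
  let T : CoEchelon α s →ₗ[ℂ] LocalSpace p :=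
    { toFun := id, map_add' _ _ := rfl, map_smul' _ _ := rfl }
  refine (continuous_of_incl T fun k => ?_).norm
  obtain ⟨M, hM⟩ := exists_mul_norm_incl_le hs hw k (hws k)
  exact AddMonoidHomClass.continuous_of_bound (T ∘ₗ incl α s k) M fun x => ciSup_le (hM x)

/-- If `E_α` is nuclear, then every weight defining a continuous supremum seminorm is summable. -/
theorem summable_of_isNuclearSpace (hα : IsExponentSequence α) (hs : IsStepSequence s)
    (hnuc : IsNuclearSpace (CoEchelon α s)) {w : ℕ → ℝ} (hw : ∀ n, 0 ≤ w n)
    (hws : ∀ k, BddAbove (Set.range fun n => w n * s k ^ α n)) : Summable w := by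
  obtain ⟨p, hp, hwp⟩ := exists_continuous_seminorm hα hs hw hws
  obtain ⟨U, hU, C, hC⟩ := (hnuc p hp).exists_sum_le
  obtain ⟨r, hr, hrU⟩ := exists_forall_ofFinsupp_mem hU 0
  have hcoord : ∀ i, ∃ g : LocalBanachSpace p →L[ℂ] ℂ, (∀ y, ‖g y‖ ≤ ‖y‖) ∧
      ∀ x, g (toLocalBanachSpace p x) = w i * toSeq x i := fun i =>
    exists_functional_localBanachSpace p ((w i : ℂ) • LinearMap.proj i ∘ₗ toSeq) fun x => by
      refine le_trans (le_of_eq ?_) (hwp x i)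
      change ‖(w i : ℂ) * toSeq x i‖ = _
      rw [norm_mul, Complex.norm_real, Real.norm_of_nonneg (hw i)]
  choose g hg hgx using hcoord
  refine summable_of_sum_le (c := C / r) hw fun I => ?_
  -- The family `r e_i` is tested against the weighted coordinates. As `v_0 ≤ 1`, its combinations
  -- with coefficients of modulus at most `1` stay in the `r`-ball of `c₀(v_0)`, whatever `I` is.
  have h := hC I (fun i => ofFinsupp α s (Finsupp.single i (r : ℂ))) g hg fun u hu => by
    simp only [← map_smul, ← map_sum]
    refine hrU _ fun n => ?_
    have hn : ‖(∑ i ∈ I, u i • Finsupp.single i (r : ℂ)) n‖ ≤ r := by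
      rw [Finsupp.finsetSum_apply]
      simp only [Finsupp.smul_apply, Finsupp.single_apply, smul_ite, smul_zero,
        Finset.sum_ite_eq']
      split_ifs
      · rw [norm_smul, Complex.norm_real, Real.norm_of_nonneg hr.le]
        exact mul_le_of_le_one_left hr.le (hu n)
      · simpa using hr.le
    rw [norm_smul, Real.norm_of_nonneg (stepWeight_pos hs 0 n).le]
    refine (mul_le_of_le_one_left (norm_nonneg _) ?_).trans hn
    exact Real.rpow_le_one_of_one_le_of_nonpos (hs.one_lt 0).le (neg_nonpos.2 (hα.pos n).le)
  rw [le_div_iff₀ hr, Finset.sum_mul]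
  refine le_trans (le_of_eq (Finset.sum_congr rfl fun i _ => ?_)) h
  rw [hgx, toSeq_ofFinsupp, Finsupp.single_eq_same, norm_mul, Complex.norm_real,
    Complex.norm_real, Real.norm_of_nonneg hr.le, Real.norm_of_nonneg (hw i)]

/-- If `E_α` is nuclear, then `α` does not grow more slowly than the logarithm. -/
theorem exists_frequently_small_of_isNuclearSpace (hα : IsExponentSequence α)
    (hs : IsStepSequence s) (hnuc : IsNuclearSpace (CoEchelon α s)) :
    ∃ t > 0, ∀ ε > 0, ∃ n : ℕ, ((n : ℝ) + 1) * t ^ (-α n) < ε := by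
  by_contra! h
  -- The negated claim at `t = s k` says exactly that the harmonic weight times `s k ^ α n` is
  -- bounded.
  refine Real.not_summable_one_div_natCast
    ((summable_nat_add_iff 1).1 (summable_of_isNuclearSpace hα hs hnuc
      (w := fun n => 1 / ((n + 1 : ℕ) : ℝ)) (fun n => by positivity) fun k => ?_))
  have hk := zero_lt_one.trans (hs.one_lt k)
  obtain ⟨ε, hε, h⟩ := h (s k) hk
  refine ⟨ε⁻¹, Set.forall_mem_range.2 fun n => ?_⟩
  have hp := Real.rpow_pos_of_pos hk (α n)
  have := h n
  rw [Real.rpow_neg hk.le, ← div_eq_mul_inv, le_div_iff₀ hp] at this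
  push_cast
  rw [one_div_mul_eq_div, div_le_iff₀ (by positivity), inv_mul_eq_div, le_div_iff₀ hε]
  linarith

/-! ### Unboundedness of the Cesàro operator -/

/-- A rapidly decreasing combination of coordinate functionals is continuous on `E_α`. -/
theorem exists_functional_eq_tsum (hα : IsExponentSequence α) (hs : IsStepSequence s)
    {b : ℕ → ℝ} (hb : ∀ j, 0 ≤ b j) {N : ℕ → ℕ}
    (hbs : ∀ k, Summable fun j => b j * s k ^ α (N j)) :
    ∃ f : CoEchelon α s →L[ℂ] ℂ, ∀ x, HasSum (fun j => (b j : ℂ) * toSeq x (N j)) (f x) := by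
  have hle : ∀ k (x : WeightedC0 (stepWeight α s k)) j,
      ‖(b j : ℂ) * toSeq (incl α s k x) (N j)‖ ≤ b j * s k ^ α (N j) * ‖x‖ := by
    intro k x j
    rw [norm_mul, Complex.norm_real, Real.norm_of_nonneg (hb j), mul_assoc]
    exact mul_le_mul_of_nonneg_left (norm_toSeq_incl_le hs k x _) (hb j)
  have hsum : ∀ x : CoEchelon α s, Summable fun j => (b j : ℂ) * toSeq x (N j) := by
    intro x
    obtain ⟨k, y, rfl⟩ := exists_incl_eq hα hs x
    exact Summable.of_norm_bounded ((hbs k).mul_right _) (hle k y)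
  let f : CoEchelon α s →ₗ[ℂ] ℂ :=
    { toFun x := ∑' j, (b j : ℂ) * toSeq x (N j)
      map_add' x y := by
        rw [← (hsum x).tsum_add (hsum y)]
        simp only [map_add, Pi.add_apply, mul_add]
      map_smul' a x := by
        rw [RingHom.id_apply, smul_eq_mul, ← (hsum x).tsum_mul_left]
        simp only [map_smul, Pi.smul_apply, smul_eq_mul, mul_left_comm] }
  refine ⟨⟨f, continuous_of_incl f fun k => ?_⟩, fun x => (hsum x).hasSum⟩
  refine AddMonoidHomClass.continuous_of_bound (f ∘ₗ incl α s k)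
    (∑' j, b j * s k ^ α (N j)) fun x => ?_
  rw [← (hbs k).tsum_mul_right]
  exact tsum_of_norm_bounded ((hbs k).mul_right _).hasSum (hle k x)

/-- If `E_α` is nuclear, then the image of a neighbourhood of `0` under the Cesàro operator is not
weakly bounded. -/
theorem exists_functional_unbounded_cesaro (hα : IsExponentSequence α) (hs : IsStepSequence s)
    (hnuc : IsNuclearSpace (CoEchelon α s)) {U : Set (CoEchelon α s)} (hU : U ∈ 𝓝 0) :
    ∃ f : CoEchelon α s →L[ℂ] ℂ, ∀ j : ℕ, ∃ x ∈ U, (j : ℝ) ≤ ‖f (cesaro hα hs x)‖ := by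
  have hs0 : ∀ k, 0 < s k := fun k => zero_lt_one.trans (hs.one_lt k)
  obtain ⟨t, ht, hsmall⟩ := exists_frequently_small_of_isNuclearSpace hα hs hnuc
  -- Passing from `s j` to `s (m j)` gains a factor `t ^ α n`; `N j` is then chosen so that this
  -- gain absorbs `N j + 1`, `j` and `1 / r j`, leaving `2⁻¹ ^ j`.
  choose m hm using fun j => (hs.tendsto.eventually_ge_atTop (t * s j)).exists
  choose r hr hrU using fun j => exists_forall_ofFinsupp_mem hU (m j)
  choose N hN using fun j : ℕ => hsmall (r j / (j + 1) * 2⁻¹ ^ j)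
    (mul_pos (div_pos (hr j) (by positivity)) (by positivity))
  have hpos : ∀ j, 0 < r j * s (m j) ^ α (N j) := fun j =>
    mul_pos (hr j) (Real.rpow_pos_of_pos (hs0 _) _)
  let b : ℕ → ℝ := fun j => j * (N j + 1) / (r j * s (m j) ^ α (N j))
  have hb : ∀ j, 0 ≤ b j := fun j => div_nonneg (by positivity) (hpos j).le
  have hbs : ∀ k, Summable fun j => b j * s k ^ α (N j) := by
    intro k
    refine (summable_geometric_of_lt_one (r := (2⁻¹ : ℝ)) (by norm_num)
      (by norm_num)).of_norm_bounded_eventually_nat ?_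
    -- For `j ≥ k`, `s k ≤ s j`, so the gain is available.
    filter_upwards [eventually_ge_atTop k] with j hj
    rw [Real.norm_of_nonneg (mul_nonneg (hb j) (Real.rpow_nonneg (hs0 k).le _))]
    have h1 : t ^ α (N j) * s k ^ α (N j) ≤ s (m j) ^ α (N j) := by
      rw [← Real.mul_rpow ht.le (hs0 k).le]
      refine Real.rpow_le_rpow (by have := hs0 k; positivity) ?_ (hα.pos _).le
      exact (mul_le_mul_of_nonneg_left (hs.strictMono.monotone hj) ht.le).trans (hm j)
    have htp := Real.rpow_pos_of_pos ht (α (N j))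
    have h2 := hN j
    rw [Real.rpow_neg ht.le, ← div_eq_mul_inv, div_lt_iff₀ htp, div_mul_eq_mul_div,
      div_mul_eq_mul_div, lt_div_iff₀ (by positivity)] at h2
    change j * (N j + 1) / (r j * s (m j) ^ α (N j)) * s k ^ α (N j) ≤ _
    rw [div_mul_eq_mul_div, div_le_iff₀ (hpos j)]
    have hskp := Real.rpow_pos_of_pos (hs0 k) (α (N j))
    calc (j : ℝ) * (N j + 1) * s k ^ α (N j)
        ≤ (N j + 1) * (j + 1) * s k ^ α (N j) := by
          refine mul_le_mul_of_nonneg_right ?_ hskp.le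
          nlinarith [(N j).cast_nonneg (α := ℝ)]
      _ ≤ r j * 2⁻¹ ^ j * t ^ α (N j) * s k ^ α (N j) :=
          mul_le_mul_of_nonneg_right h2.le hskp.le
      _ = 2⁻¹ ^ j * r j * (t ^ α (N j) * s k ^ α (N j)) := by ring
      _ ≤ 2⁻¹ ^ j * r j * s (m j) ^ α (N j) :=
          mul_le_mul_of_nonneg_left h1 (mul_nonneg (by positivity) (hr j).le)
      _ = 2⁻¹ ^ j * (r j * s (m j) ^ α (N j)) := by ring
  obtain ⟨f, hf⟩ := exists_functional_eq_tsum hα hs hb hbs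
  refine ⟨f, fun j => ?_⟩
  set n := N j with hn
  set a : ℝ := r j * s (m j) ^ α n with ha
  have ha0 : 0 < a := hpos j
  -- The partial sums of this difference vanish except at `n`.
  let x : ℕ →₀ ℂ := Finsupp.single n (a : ℂ) - Finsupp.single (n + 1) (a : ℂ)
  have hx : ∀ i, x i = (if n = i then (a : ℂ) else 0) - if n + 1 = i then (a : ℂ) else 0 :=
    fun i => by simp only [x, Finsupp.sub_apply, Finsupp.single_apply]
  refine ⟨ofFinsupp α s x, hrU j x fun i => ?_, ?_⟩
  · rw [norm_smul, Real.norm_of_nonneg (stepWeight_pos hs _ i).le]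
    -- `a` is the largest multiple of `e_n` in the `r j`-ball of `c₀(v_{m j})`; the decreasing
    -- weight takes care of `n + 1`.
    have key : n ≤ i → stepWeight α s (m j) i * a ≤ r j := fun hi => by
      refine (mul_le_mul_of_nonneg_right (stepWeight_antitone hα hs _ hi) ha0.le).trans_eq ?_
      rw [ha, mul_left_comm, stepWeight, ← Real.rpow_add (hs0 _), neg_add_cancel,
        Real.rpow_zero, mul_one]
    rw [hx]
    rcases eq_or_ne n i with rfl | h1
    · simpa [abs_of_pos ha0] using key le_rfl
    rcases eq_or_ne (n + 1) i with rfl | h2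
    · simpa [abs_of_pos ha0] using key (Nat.le_succ n)
    · simpa [h1, h2] using (hr j).le
  · have hC : ∀ i, toSeq (cesaro hα hs (ofFinsupp α s x)) i
        = if i = n then ((a / (n + 1) : ℝ) : ℂ) else 0 := by
      intro i
      rw [toSeq_cesaro, toSeq_ofFinsupp]
      change (∑ l ∈ Finset.range (i + 1), x l) / ((i : ℂ) + 1) = _
      simp only [hx, Finset.sum_sub_distrib, Finset.sum_ite_eq, Finset.mem_range]
      rcases lt_trichotomy i n with h | rfl | h
      · rw [if_neg (by omega), if_neg (by omega), if_neg (by omega), sub_zero, zero_div]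
      · rw [if_pos (by omega), if_neg (by omega), if_pos rfl, sub_zero]
        push_cast
        rfl
      · rw [if_pos (by omega), if_pos (by omega), if_neg (by omega), sub_self, zero_div]
    have hre := Complex.hasSum_re (hf (cesaro hα hs (ofFinsupp α s x)))
    refine le_trans ?_ (Complex.re_le_norm _)
    -- `N` need not be injective, so other terms may be nonzero; being nonnegative, they cannot
    -- cancel the `j`-th one, which equals `j`.
    have hterm : ∀ i, (0 : ℝ) ≤
        ((b i : ℂ) * toSeq (cesaro hα hs (ofFinsupp α s x)) (N i)).re := by
      intro i
      rw [hC]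
      split_ifs
      · rw [← Complex.ofReal_mul, Complex.ofReal_re]
        exact mul_nonneg (hb i) (div_nonneg ha0.le (by positivity))
      · simp
    refine le_trans (le_of_eq ?_) (le_hasSum hre j fun i _ => hterm i)
    rw [hC, if_pos hn.symm, ← Complex.ofReal_mul, Complex.ofReal_re]
    change (j : ℝ) = j * (n + 1) / a * (a / (n + 1))
    field_simp

end CoEchelon

/-! ### Weak compactness and conclusion -/

/-- Continuous linear functionals are bounded on weakly compact sets. -/
theorem exists_norm_le_of_isCompact_toWeakSpace {E : Type*} [AddCommGroup E] [Module ℂ E]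
    [TopologicalSpace E] [IsTopologicalAddGroup E] [ContinuousSMul ℂ E]
    {K : Set (WeakSpace ℂ E)} (hK : IsCompact K)
    (f : E →L[ℂ] ℂ) : ∃ M : ℝ, ∀ x, toWeakSpace ℂ E x ∈ K → ‖f x‖ ≤ M := by
  have hf : Continuous fun x : WeakSpace ℂ E => f ((toWeakSpace ℂ E).symm x) :=
    WeakBilin.eval_continuous _ f
  obtain ⟨M, hM⟩ := hK.exists_bound_of_continuousOn hf.continuousOn
  exact ⟨M, fun x hx => hM _ hx⟩

theorem corollary2p11 (α s : ℕ → ℝ) (hα : IsExponentSequence α) (hs : IsStepSequence s)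
    (hnuc : IsNuclearSpace (CoEchelon α s)) :
    ¬ IsCompactOperator (cesaro hα hs) ∧ ¬ IsWeaklyCompactOperator (cesaro hα hs) := by
  have key : ∀ U ∈ 𝓝 (0 : CoEchelon α s), ∀ K : Set (WeakSpace ℂ (CoEchelon α s)),
      IsCompact K → ¬ ∀ x ∈ U, toWeakSpace ℂ (CoEchelon α s) (cesaro hα hs x) ∈ K := by
    intro U hU K hK h
    obtain ⟨f, hf⟩ := CoEchelon.exists_functional_unbounded_cesaro hα hs hnuc hU
    obtain ⟨M, hM⟩ := exists_norm_le_of_isCompact_toWeakSpace hK f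
    obtain ⟨j, hj⟩ := exists_nat_gt M
    obtain ⟨x, hx, hxj⟩ := hf j
    exact (hj.trans_le hxj).not_ge (hM _ (h x hx))
  constructor
  · rintro ⟨K, hK, hU⟩
    -- A compact set is weakly compact, because the identity into the weak topology is continuous.
    exact key _ hU _ (hK.image (toWeakSpaceCLM ℂ (CoEchelon α s)).continuous)
      fun x hx => ⟨_, hx, rfl⟩
  · rintro ⟨U, hU, hK⟩
    exact key U hU _ hK fun x hx => subset_closure ⟨_, ⟨x, hx, rfl⟩, rfl⟩

end
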